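/- Let $H_0$ be the discrete Laplacian on $\ell^2(\mathbb Z)$, $(H_0x)(n)=2x(n)-x(n+1)-x(n-1)$, whose spectrum is $[0,4]$ with thresholds $0$ and $4$. Let $A_0$ be the unique selfadjoint extension (the closure) of the symmetric operator defined on finitely supported sequences by $(A_0x)(n)=i(n+\tfrac12)x(n+1)-i(n-\tfrac12)x(n-1)$; under the Fourier transform $x\mapsto(2\pi)^{-1/2}\sum_n x(n)e^{-in\vartheta}$ it is $\sin\vartheta\,(-i\partial_\vartheta)+(-i\partial_\vartheta)\sin\vartheta$. Let $\mathcal A(A_0)$ be the set of bounded operators $B$ on $\ell^2(\mathbb Z)$ such that, for some $R>0$, the map $\theta\mapsto e^{i\theta A_0}Be^{-i\theta A_0}$, $\theta\in\mathbb R$, has an extension to the disk $\{\theta\in\mathbb C:|\theta|<R\}$ that is holomorphic in operator norm. For a bounded operator $L$, let $\sigma_{\mathrm{disc}}(L)$ be the set of isolated points $z$ of $\sigma(L)$ whose algebraic multiplicity, the rank of $\frac1{2\pi i}\oint_{|\zeta-z|=r}(L-\zeta)^{-1}\,d\zeta$ for small $r>0$, is finite. **Theorem.** If $V$ is a compact operator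 on $\ell^2(\mathbb Z)$ (not necessarily selfadjoint) with $V\in\mathcal A(A_0)$, then every limit point of $\sigma_{\mathrm{disc}}(H_0+V)$ in $\mathbb C$ belongs to $\{0,4\}$. -/

import Mathlib

open scoped lp

namespace ComplexScaling

noncomputable section

/-- The Hilbert space of square-summable complex sequences indexed by the integers. -/
abbrev ellTwo : Type := ℓ²(ℤ, ℂ)

theorem memlp_shift {x : ℤ → ℂ} (hx : Memℓp x 2) (k : ℤ) :
    Memℓp (fun n : ℤ => x (n + k)) 2 := by
  have h0 : 0 < (2 : ENNReal).toReal := by norm_num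
  rw [memℓp_gen_iff h0] at hx ⊢
  exact (Equiv.addRight k).summable_iff.mpr hx

theorem memlp_of_finite {x : ℤ → ℂ} (hx : {n : ℤ | x n ≠ 0}.Finite) : Memℓp x 2 :=
  (memℓp_zero hx).of_exponent_ge zero_le

/-- Translation by `k`, `(T x)(n) = x (n + k)`, as a linear map. -/
def shiftLin (k : ℤ) : ellTwo →ₗ[ℂ] ellTwo where
  toFun x := ⟨fun n => x (n + k), memlp_shift (lp.memℓp x) k⟩
  map_add' _ _ := rfl
  map_smul' _ _ := rfl

theorem norm_shiftLin (k : ℤ) (x : ellTwo) : ‖shiftLin k x‖ = ‖x‖ := by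
  have h0 : 0 < (2 : ENNReal).toReal := by norm_num
  rw [lp.norm_eq_tsum_rpow h0, lp.norm_eq_tsum_rpow h0]
  congr 1
  exact (Equiv.addRight k).tsum_eq (fun n => ‖x n‖ ^ (2 : ENNReal).toReal)

/-- Translation by `k`, `(T x)(n) = x (n + k)`, as a bounded operator. -/
def shift (k : ℤ) : ellTwo →L[ℂ] ellTwo :=
  (shiftLin k).mkContinuous 1 fun x => by rw [norm_shiftLin, one_mul]

/-- The discrete Laplacian `(H₀ x)(n) = 2 x(n) - x(n + 1) - x(n - 1)`. -/
def freeHamiltonian : ellTwo →L[ℂ] ellTwo :=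
  (2 : ℂ) • ContinuousLinearMap.id ℂ ellTwo - shift 1 - shift (-1)

theorem freeHamiltonian_apply (x : ellTwo) (n : ℤ) :
    freeHamiltonian x n = 2 * x n - x (n + 1) - x (n - 1) := rfl

/-- The finitely supported sequences, i.e. the span of the canonical basis. -/
def finSupp : Submodule ℂ ellTwo where
  carrier := {x | {n : ℤ | x n ≠ 0}.Finite}
  zero_mem' := by simp
  add_mem' := by
    intro a b ha hb
    refine (Set.Finite.union ha hb).subset fun n hn => ?_
    by_contra h
    simp only [Set.mem_union, Set.mem_ofPred_eq, not_or, not_not] at h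
    exact hn (by simp [h.1, h.2])
  smul_mem' := by
    intro c a ha
    refine Set.Finite.subset ha fun n hn h => hn (by simp [h])

/-- The sequence `n ↦ i (n + 1/2) x(n + 1) - i (n - 1/2) x(n - 1)`. In the Fourier variable
`x ↦ (2π)^(-1/2) ∑ₙ x(n) e^(-inϑ)` this is `sin ϑ (-i ∂) + (-i ∂) sin ϑ`. -/
def conjSeq (x : ℤ → ℂ) (n : ℤ) : ℂ :=
  Complex.I * ((n : ℂ) + 1 / 2) * x (n + 1) - Complex.I * ((n : ℂ) - 1 / 2) * x (n - 1)

theorem conjSeq_finite {x : ℤ → ℂ} (hx : {n : ℤ | x n ≠ 0}.Finite) :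
    {n : ℤ | conjSeq x n ≠ 0}.Finite := by
  refine ((hx.image fun n => n - 1).union (hx.image fun n => n + 1)).subset fun n hn => ?_
  by_contra h
  simp only [Set.mem_union, Set.mem_image, Set.mem_ofPred_eq, not_or, not_exists, not_and] at h
  have h1 : x (n + 1) = 0 := by
    by_contra h'
    exact h.1 _ h' (by ring)
  have h2 : x (n - 1) = 0 := by
    by_contra h'
    exact h.2 _ h' (by ring)
  exact hn (by simp [conjSeq, h1, h2])

/-- The symmetric operator `sin ϑ (-i ∂) + (-i ∂) sin ϑ` in `ℓ²(ℤ)`, on finitely supported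
sequences. -/
def conjCore : ellTwo →ₗ.[ℂ] ellTwo where
  domain := finSupp
  toFun :=
    { toFun := fun x => ⟨conjSeq x.1, memlp_of_finite (conjSeq_finite x.2)⟩
      map_add' := by
        intro x y
        ext n
        change conjSeq (x.1 + y.1 : ellTwo) n = conjSeq x.1 n + conjSeq y.1 n
        simp only [conjSeq, lp.coeFn_add, Pi.add_apply]
        ring
      map_smul' := by
        intro c x
        ext n
        change conjSeq (c • x.1 : ellTwo) n = c * conjSeq x.1 n
        simp only [conjSeq, lp.coeFn_smul, Pi.smul_apply, smul_eq_mul]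
        ring }

theorem conjCore_apply (x : conjCore.domain) (n : ℤ) :
    conjCore x n = conjSeq (x : ellTwo) n := rfl

theorem conjCore_dense : Dense (conjCore.domain : Set ellTwo) := by
  intro x
  refine mem_closure_of_tendsto (lp.hasSum_single (by norm_num) x) (Filter.Eventually.of_forall ?_)
  intro s
  refine Submodule.sum_mem _ fun i _ => ?_
  refine (Set.finite_singleton i).subset fun n hn => ?_
  by_contra h
  exact hn (lp.single_apply_ne (E := fun _ : ℤ => ℂ) 2 i (x i) h)

theorem conjCore_symmetric : conjCore.IsFormalAdjoint conjCore := by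
  intro x y
  have hs : ∀ (a b : ℤ → ℂ), {n : ℤ | a n ≠ 0}.Finite → ∀ c : ℤ → ℂ,
      Summable fun n => c n * (b n * (starRingEnd ℂ) (a n)) := by
    intro a b ha c
    refine summable_of_hasFiniteSupport (ha.subset fun n hn h => hn ?_)
    simp [h]
  have hx : {n : ℤ | (x : ellTwo) n ≠ 0}.Finite := x.2
  have hx1 : {n : ℤ | (x : ellTwo) (n + 1) ≠ 0}.Finite := by
    refine (hx.image fun n => n - 1).subset fun n hn => ⟨n + 1, hn, by ring⟩
  have hx2 : {n : ℤ | (x : ellTwo) (n - 1) ≠ 0}.Finite := by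
    refine (hx.image fun n => n + 1).subset fun n hn => ⟨n - 1, hn, by ring⟩
  set u : ℤ → ℂ := (x : ellTwo).1 with hu
  set v : ℤ → ℂ := (y : ellTwo).1 with hv
  have e1 := (Equiv.addRight (1 : ℤ)).tsum_eq
    (fun n : ℤ => Complex.I * ((n : ℂ) - 1 / 2) * (v (n - 1) * (starRingEnd ℂ) (u n)))
  have e2 := (Equiv.addRight (1 : ℤ)).tsum_eq
    (fun n : ℤ => Complex.I * ((n : ℂ) - 1 / 2) * (v n * (starRingEnd ℂ) (u (n - 1))))
  simp only [Equiv.coe_addRight, add_sub_cancel_right] at e1 e2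
  rw [lp.inner_eq_tsum, lp.inner_eq_tsum]
  simp only [RCLike.inner_apply, conjCore_apply, ← hu, ← hv]
  have l1 : ∀ n : ℤ, v n * (starRingEnd ℂ) (conjSeq u n) =
      Complex.I * ((n : ℂ) - 1 / 2) * (v n * (starRingEnd ℂ) (u (n - 1))) -
      Complex.I * ((n : ℂ) + 1 / 2) * (v n * (starRingEnd ℂ) (u (n + 1))) := by
    intro n
    simp only [conjSeq, map_sub, map_mul, map_add, Complex.conj_I, map_intCast, map_div₀,
      map_one, map_ofNat]
    ring
  have l2 : ∀ n : ℤ, conjSeq v n * (starRingEnd ℂ) (u n) =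
      Complex.I * ((n : ℂ) + 1 / 2) * (v (n + 1) * (starRingEnd ℂ) (u n)) -
      Complex.I * ((n : ℂ) - 1 / 2) * (v (n - 1) * (starRingEnd ℂ) (u n)) := by
    intro n
    simp only [conjSeq]
    ring
  simp_rw [l1, l2]
  rw [Summable.tsum_sub (hs _ _ hx2 _) (hs _ _ hx1 _),
    Summable.tsum_sub (hs u (fun n => v (n + 1)) hx _) (hs u (fun n => v (n - 1)) hx _),
    ← e1, ← e2]
  congr 1
  all_goals
    refine tsum_congr fun n => ?_
    push_cast
    ring

/-- Being symmetric and densely defined, `conjCore` has a closure. -/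
theorem conjCore_isClosable : conjCore.IsClosable :=
  (LinearPMap.adjoint_isClosed conjCore_dense).isClosable.leIsClosable
    (conjCore_symmetric.le_adjoint conjCore_dense)

/-- The conjugate operator `A₀`: the operator `conjCore` is essentially selfadjoint, and its unique
selfadjoint extension is its closure. -/
def conjugateOperator : ellTwo →ₗ.[ℂ] ellTwo := conjCore.closure

section General

variable {H : Type*} [NormedAddCommGroup H] [InnerProductSpace ℂ H] [CompleteSpace H]

/-- `U θ = e^{iθA}`: `U` is the strongly continuous one-parameter unitary group with generator `A`,
i.e. the domain of `A` is the set of `x` for which `θ ↦ U θ x` is differentiable at `0`, and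
the derivative is then `i A x`. For selfadjoint `A` there is exactly one such `U`. -/
structure IsUnitaryGroupOf (A : H →ₗ.[ℂ] H) (U : ℝ → H →L[ℂ] H) : Prop where
  unitary_mem : ∀ θ : ℝ, U θ ∈ unitary (H →L[ℂ] H)
  map_zero : U 0 = 1
  map_add : ∀ s t : ℝ, U (s + t) = U s * U t
  continuous_apply : ∀ x : H, Continuous fun θ : ℝ => U θ x
  generator : ∀ x y : H,
    (x, y) ∈ A.graph ↔ HasDerivAt (fun θ : ℝ => U θ x) (Complex.I • y) 0

/-- The class `𝒜_R(A)`: the map `θ ↦ e^{iθA} B e^{-iθA}`, `θ` real, has an extension which is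
holomorphic, in operator norm, on the open disk of radius `R` about `0`. -/
def MemAnalyticClassRadius (A : H →ₗ.[ℂ] H) (R : ℝ) (B : H →L[ℂ] H) : Prop :=
  ∃ U : ℝ → H →L[ℂ] H, IsUnitaryGroupOf A U ∧
    ∃ F : ℂ → H →L[ℂ] H, DifferentiableOn ℂ F (Metric.ball 0 R) ∧
      ∀ θ : ℝ, |θ| < R → F (θ : ℂ) = U θ * B * U (-θ)

/-- The class `𝒜(A)`, the union of the classes `𝒜_R(A)` over `R > 0`. -/
def MemAnalyticClass (A : H →ₗ.[ℂ] H) (B : H →L[ℂ] H) : Prop :=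
  ∃ R : ℝ, 0 < R ∧ MemAnalyticClassRadius A R B

/-- The Riesz projection `(2πi)⁻¹ ∮ (ζ - L)⁻¹ dζ` over the positively oriented circle `|ζ - z| = r`. -/
def rieszProjection (L : H →L[ℂ] H) (z : ℂ) (r : ℝ) : H →L[ℂ] H :=
  (2 * Real.pi * Complex.I : ℂ)⁻¹ • ∮ ζ in C(z, r), resolvent L ζ

/-- `z` is a discrete eigenvalue of `L`: an isolated point of the spectrum, the only one inside
or on some circle `|ζ - z| = r`, whose algebraic multiplicity, the rank of the Riesz projection of
that circle, is finite. -/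
def IsDiscreteEigenvalue (L : H →L[ℂ] H) (z : ℂ) : Prop :=
  ∃ r : ℝ, 0 < r ∧ spectrum ℂ L ∩ Metric.closedBall z r = {z} ∧
    FiniteDimensional ℂ (LinearMap.range (rieszProjection L z r : H →ₗ[ℂ] H))

/-- The discrete spectrum. -/
def discreteSpectrum (L : H →L[ℂ] H) : Set ℂ :=
  {z | z ∈ spectrum ℂ L ∧ IsDiscreteEigenvalue L z}

end General

end

end ComplexScaling

/-!
Conjugation by `e^{iθA₀}` acts on the Laplacian by a Möbius map. Since `i [A₀, H₀] = H₀ (4 - H₀)`,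
the conjugates `W θ` of `H₀` solve the logistic equation `W' = W (4 - W)`, so that
`W θ = 4 e^{2θ} H₀ / (e^{2θ} H₀ + e^{-2θ} (4 - H₀))`: the thresholds `0` and `4` are fixed and
`H₀ / (4 - H₀)` is multiplied by `e^{4θ}` (`LogisticCommutator.conj_mul_dilationDenom`). For complex
`θ` the interval `[0, 4]` is thereby turned into a circular arc from `0` to `4`, which meets the
real axis only at its end points when `Im θ` is small and nonzero.

Clearing denominators, write `D θ = e^{2θ} H₀ + e^{-2θ} (4 - H₀)` and consider the family
`4 e^{2θ} H₀ - z D θ + F θ D θ`, where `F` is the analytic extension of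
`θ ↦ e^{iθA₀} V e^{-iθA₀}`. For real `θ` it equals `e^{iθA₀} (H₀ + V - z) e^{-iθA₀} D θ`. The values
of `F` are compact also for complex `θ` (`isCompactOperator_of_forall_real`), and the free part is
invertible as long as `z` is off the arc (`isUnit_freePencil`), so the analytic Fredholm theorem
(`not_isUnit_of_frequently_not_isUnit`) applies in `θ` and in `z` separately.

* In `θ`: for a point `z` of the spectrum off the real axis the family is non-invertible at all real
  `θ`, hence at all small `θ` in the half-plane where the arc moves away from `z`.
* In `z`: at such a fixed nonreal `θ`, the free part is invertible near each point of `(0, 4)`, so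
  the exceptional `z` from the corresponding half-plane cannot accumulate there.

Outside `[0, 4]` the analytic Fredholm theorem at `θ = 0` excludes accumulation. Finally, real
points of `(0, 4)` are never discrete eigenvalues, because all of `(0, 4)` lies in the spectrum of
`H₀ + V` (`mem_spectrum_freeHamiltonian_add`).
-/

namespace ComplexScaling

noncomputable section

open Filter Topology

/-! ### Analytic families of compact operators -/

section AnalyticFredholm

variable {H : Type*} [NormedAddCommGroup H] [InnerProductSpace ℂ H]

/-- The range of a compact operator is approximated in norm by a finite-dimensional subspace: the
span of a finite net of the image of the unit ball. -/
theorem exists_norm_sub_starProjection_mul_lt {K : H →L[ℂ] H} (hK : IsCompactOperator K) {ε : ℝ}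
    (hε : 0 < ε) : ∃ (W : Submodule ℂ H) (_ : FiniteDimensional ℂ W),
      ‖(1 - W.starProjection) * K‖ < ε := by
  have hK' := (hK.isCompact_closure_image_closedBall (1 : ℝ)).totallyBounded
  obtain ⟨t, ht, hcov⟩ := Metric.totallyBounded_iff.mp hK' (ε / 2) (by positivity)
  have hfin : FiniteDimensional ℂ (Submodule.span ℂ t) := FiniteDimensional.span_of_finite ℂ ht
  refine ⟨Submodule.span ℂ t, hfin, ?_⟩
  refine lt_of_le_of_lt (ContinuousLinearMap.opNorm_le_of_unit_norm (C := ε / 2) (by positivity) ?_)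
    (by linarith)
  intro x hx
  have hmem : K x ∈ closure (K '' Metric.closedBall 0 1) :=
    subset_closure ⟨x, by simp [hx], rfl⟩
  obtain ⟨y, hy, hxy⟩ := Set.mem_iUnion₂.mp (hcov hmem)
  have h1 : ‖K x - (Submodule.span ℂ t).starProjection (K x)‖ ≤ ‖K x - y‖ := by
    rw [Submodule.starProjection_minimal]
    exact ciInf_le ⟨0, by rintro _ ⟨w, rfl⟩; exact norm_nonneg _⟩
      (⟨y, Submodule.subset_span hy⟩ : Submodule.span ℂ t)
  have h2 : ‖K x - y‖ < ε / 2 := by simpa [dist_eq_norm] using hxy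
  calc ‖((1 - (Submodule.span ℂ t).starProjection) * K) x‖
      = ‖K x - (Submodule.span ℂ t).starProjection (K x)‖ := by simp
    _ ≤ ε / 2 := h1.trans h2.le

theorem isUnit_one_add_comp {X Y : Type*} [NormedAddCommGroup X] [NormedSpace ℂ X]
    [NormedAddCommGroup Y] [NormedSpace ℂ Y] (a : X →L[ℂ] Y) (b : Y →L[ℂ] X)
    (h : IsUnit (1 + a ∘L b)) : IsUnit (1 + b ∘L a) := by
  obtain ⟨u, hu⟩ := h
  set c : Y →L[ℂ] Y := ((u⁻¹ : (Y →L[ℂ] Y)ˣ) : Y →L[ℂ] Y)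
  have h1 : ∀ y, c y + a (b (c y)) = y := fun y => by
    have := congrArg (fun f : Y →L[ℂ] Y => f y) u.mul_inv
    simpa [hu] using this
  have h2 : ∀ y, c y + c (a (b y)) = y := fun y => by
    have := congrArg (fun f : Y →L[ℂ] Y => f y) u.inv_mul
    simpa [hu] using this
  refine ⟨⟨1 + b ∘L a, 1 - b ∘L c ∘L a, ?_, ?_⟩, rfl⟩
  · ext x
    have := congrArg b (h1 (a x))
    simp only [map_add] at this
    simp only [mul_apply_eq_comp, add_apply, sub_apply, one_apply_eq_self,
      ContinuousLinearMap.comp_apply, map_sub]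
    rw [← this]
    abel
  · ext x
    have := congrArg b (h2 (a x))
    simp only [map_add] at this
    simp only [mul_apply_eq_comp, add_apply, sub_apply, one_apply_eq_self,
      ContinuousLinearMap.comp_apply, map_add]
    linear_combination (norm := module) -this

variable [CompleteSpace H]

/-- Near a point, invertibility of an analytic family `1 + K z` with `K z₀` compact is governed by
the zeros of one scalar analytic function: splitting off a finite-dimensional block of `K`, what
remains has norm below `1`, and the block contributes a determinant. -/
theorem exists_analyticAt_isUnit_iff {K : ℂ → H →L[ℂ] H} {z₀ : ℂ} (hK : AnalyticAt ℂ K z₀)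
    (hc : IsCompactOperator (K z₀)) :
    ∃ d : ℂ → ℂ, AnalyticAt ℂ d z₀ ∧ ∀ᶠ z in 𝓝 z₀, (IsUnit (1 + K z) ↔ d z ≠ 0) := by
  obtain ⟨W, hW, hnorm⟩ := exists_norm_sub_starProjection_mul_lt hc one_pos
  set A : ℂ → H →L[ℂ] H := fun z => 1 + (1 - W.starProjection) * K z with hA
  have hAan : AnalyticAt ℂ A z₀ := analyticAt_const.add (analyticAt_const.mul hK)
  have hA0 : IsUnit (A z₀) := by
    have := isUnit_one_sub_of_norm_lt_one (x := -((1 - W.starProjection) * K z₀))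
      (by rwa [norm_neg])
    rwa [sub_neg_eq_add] at this
  have hAu : ∀ᶠ z in 𝓝 z₀, IsUnit (A z) :=
    hAan.continuousAt.eventually (Units.isOpen.mem_nhds hA0)
  set T : ℂ → H →L[ℂ] H := fun z => K z * Ring.inverse (A z) with hT
  have hTan : AnalyticAt ℂ T z₀ := by
    refine hK.mul ?_
    obtain ⟨u, hu⟩ := hA0
    exact AnalyticAt.comp (g := Ring.inverse) (f := A) (by rw [← hu]; exact analyticAt_inverse u)
      hAan
  set b := stdOrthonormalBasis ℂ W
  set S : ℂ → W →L[ℂ] W := fun z => (W.orthogonalProjectionOnto ∘L T z) ∘L W.subtypeL with hS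
  set M : ℂ → Matrix _ _ ℂ := fun z =>
    LinearMap.toMatrix b.toBasis b.toBasis ((1 + S z : W →L[ℂ] W) : W →ₗ[ℂ] W) with hM
  refine ⟨fun z => (M z).det, ?_, ?_⟩
  · simp only [Matrix.det_apply]
    refine Finset.analyticAt_fun_sum _ fun σ _ => ?_
    refine AnalyticAt.const_smul (Finset.analyticAt_fun_prod _ fun i _ => ?_)
    have : (fun z => M z (σ i) i) = fun z =>
        (innerSL ℂ (b (σ i))) (b i + W.orthogonalProjectionOnto (T z (b i))) := by
      funext z
      simp [hM, hS, LinearMap.toMatrix_apply, -map_add, -LinearMap.toMatrix_one,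
        OrthonormalBasis.repr_apply_apply, inner_add_right]
    rw [this]
    refine ((innerSL ℂ (b (σ i))).analyticAt _).comp (analyticAt_const.add ?_)
    exact (W.orthogonalProjectionOnto.analyticAt _).comp
      (((ContinuousLinearMap.apply ℂ H (b i : H)).analyticAt _).comp hTan)
  · filter_upwards [hAu] with z hz
    have hfac : 1 + K z = (1 + (W.subtypeL ∘L (W.orthogonalProjectionOnto ∘L T z))) * A z := by
      have h1 : W.subtypeL ∘L (W.orthogonalProjectionOnto ∘L T z) = W.starProjection * T z := rfl
      have h2 : T z * A z = K z := by
        rw [hT]; simp only; rw [mul_assoc, Ring.inverse_mul_cancel _ hz, mul_one]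
      rw [h1, add_mul, mul_assoc, h2, hA]
      noncomm_ring
    have hunit : IsUnit (1 + K z) ↔ IsUnit (1 + S z) := by
      obtain ⟨u, hu⟩ := hz
      rw [hfac, ← hu, Units.isUnit_mul_units]
      exact ⟨fun h => isUnit_one_add_comp _ _ h, fun h => isUnit_one_add_comp _ _ h⟩
    rw [hunit, ContinuousLinearMap.isUnit_iff_bijective, hM]
    simp only
    rw [LinearMap.det_toMatrix, ← isUnit_iff_ne_zero, ← LinearMap.isUnit_iff_isUnit_det,
      Module.End.isUnit_iff]
    rfl

/-- **Analytic Fredholm theorem**, in the form of an identity principle: if `L z + K z` is an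
analytic family on a connected open set with `L z` invertible and `K z` compact, and it is
non-invertible at points accumulating inside the set, then it is nowhere invertible. -/
theorem not_isUnit_of_frequently_not_isUnit {Ω : Set ℂ} (hΩ : IsOpen Ω) (hΩc : IsPreconnected Ω)
    {L K : ℂ → H →L[ℂ] H} (hL : DifferentiableOn ℂ L Ω) (hK : DifferentiableOn ℂ K Ω)
    (hLu : ∀ z ∈ Ω, IsUnit (L z)) (hKc : ∀ z ∈ Ω, IsCompactOperator (K z)) {z₀ : ℂ}
    (hz₀ : z₀ ∈ Ω) (hf : ∃ᶠ z in 𝓝[≠] z₀, ¬ IsUnit (L z + K z)) :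
    ∀ z ∈ Ω, ¬ IsUnit (L z + K z) := by
  have hdich : ∀ z ∈ Ω, (∀ᶠ w in 𝓝 z, ¬ IsUnit (L w + K w)) ∨
      ∀ᶠ w in 𝓝[≠] z, IsUnit (L w + K w) := by
    intro z hz
    have hd : DifferentiableOn ℂ (fun w => Ring.inverse (L w) * K w) Ω :=
      (hL.inverse hLu).mul hK
    have hcz : IsCompactOperator (Ring.inverse (L z) * K z) := (hKc z hz).clm_comp _
    obtain ⟨d, hd, hiff⟩ := exists_analyticAt_isUnit_iff (hd.analyticAt (hΩ.mem_nhds hz)) hcz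
    have hiff' : ∀ᶠ w in 𝓝 z, (IsUnit (L w + K w) ↔ d w ≠ 0) := by
      filter_upwards [hiff, hΩ.mem_nhds hz] with w hw hwΩ
      rw [← hw]
      have hu := hLu w hwΩ
      have : L w + K w = L w * (1 + Ring.inverse (L w) * K w) := by
        rw [mul_add, mul_one, ← mul_assoc, Ring.mul_inverse_cancel _ hu, one_mul]
      obtain ⟨u, hu⟩ := hu
      rw [this, ← hu, Units.isUnit_units_mul]
    rcases hd.eventually_eq_zero_or_eventually_ne_zero with h | h
    · left
      filter_upwards [hiff', h] with w h1 h2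
      simp [h1, h2]
    · right
      filter_upwards [hiff'.filter_mono nhdsWithin_le_nhds, h] with w h1 h2
      exact h1.mpr h2
  have hcont : ∀ z ∈ Ω, ContinuousAt (fun w => L w + K w) z := fun z hz =>
    ((hL.add hK).differentiableAt (hΩ.mem_nhds hz)).continuousAt
  have hsub : Ω ⊆ {z | ∀ᶠ w in 𝓝 z, ¬ IsUnit (L w + K w)} := by
    refine hΩc.subset_left_of_subset_union (v := {z | z ∈ Ω ∧ ∀ᶠ w in 𝓝[≠] z, IsUnit (L w + K w)})
      (isOpen_setOfPred_eventually_nhds) ?_ ?_ (fun z hz => ?_) ⟨z₀, hz₀, ?_⟩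
    · rw [isOpen_iff_mem_nhds]
      rintro z ⟨hz, hev⟩
      have h2 := eventually_eventually_nhds.mpr (eventually_nhdsWithin_iff.mp hev)
      filter_upwards [h2, hΩ.mem_nhds hz] with w hw hwΩ
      exact ⟨hwΩ, by
        by_cases hwz : w = z
        · rw [hwz]; exact hev
        · exact nhdsWithin_le_nhds ((hcont w hwΩ).eventually
            (Units.isOpen.mem_nhds (hw.self_of_nhds hwz)))⟩
    · rw [Set.disjoint_left]
      rintro z h1 ⟨-, h2⟩
      obtain ⟨w, hw1, hw2⟩ := ((h1.filter_mono nhdsWithin_le_nhds).and h2).exists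
      exact hw1 hw2
    · exact (hdich z hz).imp id fun h => ⟨hz, h⟩
    · exact (hdich z₀ hz₀).resolve_right fun h => hf (h.mono fun _ hw => not_not.mpr hw)
  exact fun z hz => (hsub hz).self_of_nhds

theorem tendsto_ofReal_nhdsNE_zero : Tendsto (fun t : ℝ => (t : ℂ)) (𝓝[≠] 0) (𝓝[≠] 0) := by
  refine tendsto_nhdsWithin_iff.mpr ⟨?_, ?_⟩
  · exact (Complex.continuous_ofReal.tendsto' 0 0 (by simp)).mono_left nhdsWithin_le_nhds
  · filter_upwards [self_mem_nhdsWithin] with t ht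
    simpa using ht

/-- An operator-valued holomorphic function on a disk about `0` whose values on the real diameter
are compact has compact values: its class modulo the closed subspace of compact operators vanishes
on the diameter, hence identically. -/
theorem isCompactOperator_of_forall_real {R : ℝ} (hR : 0 < R) {F : ℂ → H →L[ℂ] H}
    (hF : DifferentiableOn ℂ F (Metric.ball 0 R))
    (hreal : ∀ θ : ℝ, |θ| < R → IsCompactOperator (F θ)) {θ : ℂ} (hθ : θ ∈ Metric.ball (0 : ℂ) R) :
    IsCompactOperator (F θ) := by
  set 𝒦 := compactOperator (RingHom.id ℂ) H H with h𝒦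
  have : IsClosed (𝒦 : Set (H →L[ℂ] H)) := isClosed_setOfPred_isCompactOperator
  let _ : NormedAddCommGroup ((H →L[ℂ] H) ⧸ 𝒦) := Submodule.Quotient.normedAddCommGroup 𝒦
  let _ : NormedSpace ℂ ((H →L[ℂ] H) ⧸ 𝒦) := Submodule.Quotient.normedSpace 𝒦 ℂ
  have hd : DifferentiableOn ℂ (fun z => 𝒦.mkQL (F z)) (Metric.ball 0 R) :=
    𝒦.mkQL.differentiable.comp_differentiableOn hF
  have han := hd.analyticOnNhd Metric.isOpen_ball
  have h0 : ∃ᶠ z in 𝓝[≠] (0 : ℂ), 𝒦.mkQL (F z) = 0 := by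
    refine tendsto_ofReal_nhdsNE_zero.frequently (Eventually.frequently ?_)
    have : ∀ᶠ t : ℝ in 𝓝 0, |t| < R := by
      have := Metric.ball_mem_nhds (0 : ℝ) hR
      filter_upwards [this] with t ht
      simpa using ht
    filter_upwards [this.filter_mono nhdsWithin_le_nhds] with t ht
    exact (Submodule.Quotient.mk_eq_zero 𝒦).mpr (hreal t ht)
  have := han.eqOn_zero_of_preconnected_of_frequently_eq_zero (convex_ball 0 R).isPreconnected
    (Metric.mem_ball_self hR) h0 hθ
  exact (Submodule.Quotient.mk_eq_zero 𝒦).mp this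

end AnalyticFredholm

/-! ### Conjugation by a unitary group -/

section UnitaryGroup

variable {H : Type*} [NormedAddCommGroup H] [InnerProductSpace ℂ H] [CompleteSpace H]
  {A : H →ₗ.[ℂ] H} {U : ℝ → H →L[ℂ] H}

namespace IsUnitaryGroupOf

theorem mul_neg (hU : IsUnitaryGroupOf A U) (θ : ℝ) : U θ * U (-θ) = 1 := by
  rw [← hU.map_add, add_neg_cancel, hU.map_zero]

theorem neg_mul (hU : IsUnitaryGroupOf A U) (θ : ℝ) : U (-θ) * U θ = 1 := by
  rw [← hU.map_add, neg_add_cancel, hU.map_zero]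

theorem isUnit (hU : IsUnitaryGroupOf A U) (θ : ℝ) : IsUnit (U θ) :=
  ⟨⟨U θ, U (-θ), hU.mul_neg θ, hU.neg_mul θ⟩, rfl⟩

theorem norm_apply (hU : IsUnitaryGroupOf A U) (θ : ℝ) (x : H) : ‖U θ x‖ = ‖x‖ :=
  ContinuousLinearMap.norm_map_of_mem_unitary (hU.unitary_mem θ) x

theorem hasDerivAt_apply (hU : IsUnitaryGroupOf A U) {x y : H} (h : (x, y) ∈ A.graph) (θ : ℝ) :
    HasDerivAt (fun s => U s x) (Complex.I • U θ y) θ := by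
  have h0 := (hU.generator x y).mp h
  have h1 : HasDerivAt (fun s : ℝ => U (s - θ) x) (Complex.I • y) θ := by
    have h2 : HasDerivAt (fun s => U s x) (Complex.I • y) (θ - θ) := by rwa [sub_self]
    simpa using h2.comp_sub_const θ θ
  have h2 := ((U θ).restrictScalars ℝ).hasFDerivAt.comp_hasDerivAt θ h1
  simp only [ContinuousLinearMap.coe_restrictScalars', map_smul] at h2
  refine h2.congr_of_eventuallyEq (Eventually.of_forall fun s => ?_)
  change U s x = (U θ * U (s - θ)) x
  rw [← hU.map_add, add_sub_cancel]

theorem apply_mem_graph (hU : IsUnitaryGroupOf A U) {x y : H} (h : (x, y) ∈ A.graph) (θ : ℝ) :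
    (U θ x, U θ y) ∈ A.graph := by
  rw [hU.generator]
  have h2 := ((U θ).restrictScalars ℝ).hasFDerivAt.comp_hasDerivAt 0 ((hU.generator x y).mp h)
  simp only [ContinuousLinearMap.coe_restrictScalars', map_smul] at h2
  refine h2.congr_of_eventuallyEq (Eventually.of_forall fun s => ?_)
  change (U s * U θ) x = (U θ * U s) x
  rw [← hU.map_add, ← hU.map_add, add_comm]

/-- Product rule for a strongly continuous group applied to a curve. No norm differentiability of
the group is needed, because its members are isometries. -/
theorem hasDerivAt_apply_curve (hU : IsUnitaryGroupOf A U) {y : ℝ → H} {y' u' : H} {θ : ℝ}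
    (hy : HasDerivAt y y' θ) (hu : HasDerivAt (fun s => U s (y θ)) u' θ) :
    HasDerivAt (fun s => U s (y s)) (u' + U θ y') θ := by
  rw [hasDerivAt_iff_isLittleO] at hy hu ⊢
  have h1 : (fun s => U s (y s - y θ - (s - θ) • y')) =o[𝓝 θ] fun s => s - θ :=
    (hy.norm_left.congr_left fun s => (hU.norm_apply s _).symm).of_norm_left
  have h2 : (fun s => (s - θ) • (U s y' - U θ y')) =o[𝓝 θ] fun s => s - θ := by
    have h3 : (fun s => U s y' - U θ y') =o[𝓝 θ] fun _ => (1 : ℝ) := by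
      rw [Asymptotics.isLittleO_one_iff]
      have := ((hU.continuous_apply y').tendsto θ).sub_const (U θ y')
      simpa using this
    simpa using (Asymptotics.isBigO_refl (fun s => s - θ) (𝓝 θ)).smul_isLittleO h3
  refine ((hu.add h1).add h2).congr_left fun s => ?_
  have : U s ((s - θ) • y') = (s - θ) • U s y' := map_real_smul (U s) (U s).continuous (s - θ) y'
  simp only [map_sub, smul_add, smul_sub, this]
  abel

end IsUnitaryGroupOf

/-- The bounded operator `e^{2θ} B + e^{-2θ} (4 - B)`, the denominator of the Möbius transform
`4 e^{2θ} B / (e^{2θ} B + e^{-2θ} (4 - B))` of `B`, which fixes `0` and `4` and multiplies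
`B / (4 - B)` by `e^{4θ}`. -/
def dilationDenom (B : H →L[ℂ] H) (θ : ℂ) : H →L[ℂ] H :=
  Complex.exp (2 * θ) • B + Complex.exp (-(2 * θ)) • ((4 : ℂ) • 1 - B)

/-- `B` preserves the domain of `A`, and `i [A, B] = B (4 - B)` there; both are expressed through
the graph of `A`. -/
def LogisticCommutator (A : H →ₗ.[ℂ] H) (B : H →L[ℂ] H) : Prop :=
  ∀ x y : H, (x, y) ∈ A.graph → (B x, B y - Complex.I • B ((4 : ℂ) • x - B x)) ∈ A.graph

/-- If `i [A, B] = B (4 - B)`, the conjugates `W` of `B` solve the logistic equation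
`W' = W (4 - W)` strongly on the domain of `A`. -/
theorem LogisticCommutator.hasDerivAt_conj {B : H →L[ℂ] H} (hB : LogisticCommutator A B)
    (hU : IsUnitaryGroupOf A U) {x y : H} (h : (x, y) ∈ A.graph) (θ : ℝ) :
    HasDerivAt (fun s => (U s * B * U (-s)) x)
      ((U θ * B * U (-θ)) ((4 : ℂ) • x - (U θ * B * U (-θ)) x)) θ := by
  have h1 : HasDerivAt (fun s : ℝ => U (-s) x) (-(Complex.I • U (-θ) y)) θ := by
    have := (hU.hasDerivAt_apply h (-θ)).scomp θ (hasDerivAt_neg θ)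
    simpa using! this
  have h2 := (B.restrictScalars ℝ).hasFDerivAt.comp_hasDerivAt θ h1
  have h3 := hU.hasDerivAt_apply (hB _ _ (hU.apply_mem_graph h (-θ))) θ
  have h4 := hU.hasDerivAt_apply_curve h2 h3
  refine h4.congr_deriv ?_
  have hinv : ∀ v, U (-θ) (U θ v) = v := fun v => by
    have := congrArg (fun f : H →L[ℂ] H => f v) (hU.neg_mul θ)
    simpa using this
  have hI : ∀ v : H, Complex.I • Complex.I • v = -v := fun v => by
    rw [smul_smul, Complex.I_mul_I, neg_one_smul]
  simp only [ContinuousLinearMap.coe_restrictScalars', map_smul, map_sub, map_neg,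
    mul_apply_eq_comp, hinv, smul_sub, hI]
  module

/-- The solution of the logistic equation: conjugation by `e^{iθA}` acts on `B` as the Möbius
transform with denominator `dilationDenom B θ`. -/
theorem LogisticCommutator.conj_mul_dilationDenom {B : H →L[ℂ] H} (hB : LogisticCommutator A B)
    (hA : Dense (A.domain : Set H)) (hU : IsUnitaryGroupOf A U) (θ : ℝ) :
    U θ * B * U (-θ) * dilationDenom B θ = (4 * Complex.exp (2 * θ)) • B := by
  set W : ℝ → H →L[ℂ] H := fun s => U s * B * U (-s) with hW
  change W θ * _ = _
  refine DFunLike.coe_injective (Continuous.ext_on hA (ContinuousLinearMap.continuous _)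
    (ContinuousLinearMap.continuous _) fun x hx => ?_)
  have hxg : (x, A ⟨x, hx⟩) ∈ A.graph := A.mem_graph ⟨x, hx⟩
  set v₁ := B x with hv₁
  set v₂ := (4 : ℂ) • x - B x with hv₂
  have hg₁ := hB _ _ hxg
  have hg₂ := A.graph.sub_mem (A.graph.smul_mem (4 : ℂ) hxg) hg₁
  have he : ∀ s : ℝ, HasDerivAt (fun s : ℝ => Complex.exp (2 * s))
      (2 * Complex.exp (2 * s)) s := fun s => by
    have := (((hasDerivAt_id (s : ℂ)).const_mul 2).cexp).comp_ofReal
    simpa [mul_comm] using! this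
  have he' : ∀ s : ℝ, HasDerivAt (fun s : ℝ => Complex.exp (-(2 * s)))
      (-2 * Complex.exp (-(2 * s))) s := fun s => by
    have := ((((hasDerivAt_id (s : ℂ)).const_mul 2).neg).cexp).comp_ofReal
    simpa [mul_comm] using! this
  set N : ℝ → H := fun s => Complex.exp (2 * s) • W s v₁ + Complex.exp (-(2 * s)) • W s v₂
    - (4 * Complex.exp (2 * s)) • v₁ with hN
  -- The discrepancy between the two sides solves the linear equation `N' = (2 - W) N`.
  have hderiv : ∀ s : ℝ, HasDerivAt N ((2 : ℂ) • N s - W s (N s)) s := fun s => by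
    have w₁ : HasDerivAt (fun s => W s v₁) (W s ((4 : ℂ) • v₁ - W s v₁)) s :=
      hB.hasDerivAt_conj hU hg₁ s
    have w₂ : HasDerivAt (fun s => W s v₂) (W s ((4 : ℂ) • v₂ - W s v₂)) s :=
      hB.hasDerivAt_conj hU hg₂ s
    have d₁ := (he s).smul w₁
    have d₂ := (he' s).smul w₂
    have d₃ := ((he s).const_mul 4).smul_const v₁
    refine ((d₁.add d₂).sub d₃).congr_deriv ?_
    simp only [hN, map_sub, map_add, map_smul]
    module
  have hN0 : N 0 = 0 := by
    simp only [hN, hW, Complex.ofReal_zero, mul_zero, neg_zero, Complex.exp_zero, hU.map_zero,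
      one_smul, mul_one, one_mul, hv₁, hv₂, map_sub, map_smul]
    module
  have hnorm : ∀ (s : ℝ) (v : H), ‖W s v‖ ≤ ‖B‖ * ‖v‖ := fun s v => by
    change ‖U s (B (U (-s) v))‖ ≤ _
    rw [hU.norm_apply]
    exact (B.le_opNorm _).trans_eq (by rw [hU.norm_apply])
  have hzero : N = fun _ => 0 := by
    refine ODE_solution_unique_univ (t₀ := 0) (v := fun s v => (2 : ℂ) • v - W s v)
      (s := fun _ => Set.univ) (K := ‖B‖₊ + 2) (fun s => ?_) (fun s => ⟨hderiv s, trivial⟩)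
      (fun s => ⟨by simpa using hasDerivAt_const s (0 : H), trivial⟩) hN0
    refine (LipschitzWith.of_dist_le_mul fun v w => ?_).lipschitzOnWith
    rw [dist_eq_norm, dist_eq_norm, show (2 : ℂ) • v - W s v - ((2 : ℂ) • w - W s w)
      = (2 : ℂ) • (v - w) - W s (v - w) by rw [map_sub]; module]
    refine (norm_sub_le _ _).trans ?_
    have := hnorm s (v - w)
    rw [norm_smul, Complex.norm_ofNat]
    push_cast
    linarith
  have := congrFun hzero θ
  simp only [hN, sub_eq_zero] at this
  simpa [dilationDenom, hv₁, hv₂] using this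

end UnitaryGroup

/-! ### The commutator of the Laplacian with the conjugate operator -/

theorem dense_conjugateOperator_domain : Dense (conjugateOperator.domain : Set ellTwo) :=
  conjCore_dense.mono conjCore.le_closure.1

theorem freeHamiltonian_mem_finSupp {x : ellTwo} (hx : x ∈ finSupp) :
    freeHamiltonian x ∈ finSupp := by
  have h1 : Set.Finite {n : ℤ | x (n + 1) ≠ 0} :=
    (Set.Finite.image (fun n => n - 1) hx).subset fun n hn => ⟨n + 1, hn, by ring⟩
  have h2 : Set.Finite {n : ℤ | x (n - 1) ≠ 0} :=
    (Set.Finite.image (fun n => n + 1) hx).subset fun n hn => ⟨n - 1, hn, by ring⟩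
  refine ((Set.Finite.union hx h1).union h2).subset fun n hn => ?_
  by_contra hc
  simp only [Set.mem_union, not_or, Set.mem_ofPred_eq, not_not] at hc
  have h0 : x n = 0 := by
    have := hc.1.1
    simpa using this
  exact hn (by rw [freeHamiltonian_apply, h0, hc.1.2, hc.2]; ring)

/-- The identity `i [A₀, H₀] = 2 - S² - S⁻² = H₀ (4 - H₀)`, where `S` is the shift. -/
theorem conjCore_freeHamiltonian (x : conjCore.domain) :
    conjCore ⟨freeHamiltonian x, freeHamiltonian_mem_finSupp x.2⟩ = freeHamiltonian (conjCore x)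
      - Complex.I • freeHamiltonian ((4 : ℂ) • (x : ellTwo) - freeHamiltonian x) := by
  ext n
  simp only [lp.coeFn_sub, lp.coeFn_smul, Pi.sub_apply, Pi.smul_apply, smul_eq_mul,
    freeHamiltonian_apply, conjCore_apply, conjSeq]
  push_cast
  rw [show n + 1 + 1 = n + 2 by ring, show n - 1 - 1 = n - 2 by ring,
    show n + 1 - 1 = n by ring, show n - 1 + 1 = n by ring]
  ring

/-- The identity on finitely supported sequences passes to the closure because `H₀` is bounded. -/
theorem logisticCommutator_freeHamiltonian :
    LogisticCommutator conjugateOperator freeHamiltonian := by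
  intro x y h
  have hgr : conjugateOperator.graph = conjCore.graph.topologicalClosure :=
    conjCore_isClosable.graph_closure_eq_closure_graph.symm
  rw [hgr] at h ⊢
  set f : ellTwo × ellTwo → ellTwo × ellTwo := fun p => (freeHamiltonian p.1,
    freeHamiltonian p.2 - Complex.I • freeHamiltonian ((4 : ℂ) • p.1 - freeHamiltonian p.1))
  have hcont : Continuous f := by fun_prop
  have hmaps : Set.MapsTo f (conjCore.graph : Set (ellTwo × ellTwo)) conjCore.graph := by
    rintro p hp
    obtain ⟨u, hu1, hu2⟩ := (LinearPMap.mem_graph_iff _).mp hp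
    refine (LinearPMap.mem_graph_iff _).mpr
      ⟨⟨freeHamiltonian u, freeHamiltonian_mem_finSupp u.2⟩, ?_, ?_⟩
    · change _ = freeHamiltonian p.1
      rw [← hu1]
    · change _ = freeHamiltonian p.2
        - Complex.I • freeHamiltonian ((4 : ℂ) • p.1 - freeHamiltonian p.1)
      rw [← hu1, ← hu2]
      exact conjCore_freeHamiltonian u
  have key : f (x, y) ∈ closure (conjCore.graph : Set (ellTwo × ellTwo)) :=
    map_mem_closure hcont h hmaps
  exact key

/-! ### Spectral properties of the Laplacian -/

theorem shift_apply (k : ℤ) (x : ellTwo) (n : ℤ) : shift k x n = x (n + k) := rfl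

theorem norm_shift_le (k : ℤ) : ‖shift k‖ ≤ 1 :=
  LinearMap.mkContinuous_norm_le _ zero_le_one _

theorem inner_shift_left (k : ℤ) (x y : ellTwo) :
    inner ℂ (shift k x) y = inner ℂ x (shift (-k) y) := by
  rw [lp.inner_eq_tsum, lp.inner_eq_tsum, ← (Equiv.addRight k).tsum_eq
    (fun n => inner ℂ (x n) (shift (-k) y n))]
  refine tsum_congr fun n => ?_
  simp [shift_apply]

theorem isSelfAdjoint_freeHamiltonian : IsSelfAdjoint freeHamiltonian := by
  rw [ContinuousLinearMap.isSelfAdjoint_iff_isSymmetric]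
  intro x y
  have h1 := inner_shift_left 1 x y
  have h2 := inner_shift_left (-1) x y
  rw [neg_neg] at h2
  change inner ℂ ((2 : ℂ) • x - shift 1 x - shift (-1) x) y
    = inner ℂ x ((2 : ℂ) • y - shift 1 y - shift (-1) y)
  simp only [inner_sub_left, inner_sub_right, inner_smul_left, inner_smul_right, h1, h2, map_ofNat]
  ring

theorem mem_Icc_of_mem_spectrum_freeHamiltonian {z : ℂ} (hz : z ∈ spectrum ℂ freeHamiltonian) :
    ∃ c ∈ Set.Icc (0 : ℝ) 4, z = c := by
  have hre := isSelfAdjoint_freeHamiltonian.mem_spectrum_eq_re hz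
  refine ⟨z.re, ?_, hre⟩
  have h2 : z - 2 ∈ spectrum ℂ (freeHamiltonian - algebraMap ℂ _ 2) := by
    rw [← spectrum.sub_singleton_eq]
    exact Set.sub_mem_sub hz rfl
  have hn : ‖freeHamiltonian - algebraMap ℂ _ 2‖ ≤ 2 := by
    have : freeHamiltonian - algebraMap ℂ _ 2 = -(shift 1 + shift (-1)) := by
      rw [freeHamiltonian, Algebra.algebraMap_eq_smul_one]
      change (2 : ℂ) • (1 : ellTwo →L[ℂ] ellTwo) - _ - _ - _ = _
      abel
    rw [this, norm_neg]
    linarith [norm_add_le (shift 1) (shift (-1)), norm_shift_le 1, norm_shift_le (-1)]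
  have h3 := (spectrum.norm_le_norm_mul_of_mem h2).trans
    (mul_le_of_le_one_right (norm_nonneg _) ContinuousLinearMap.norm_id_le)
  have h4 : |z.re - 2| ≤ 2 := by
    have := Complex.abs_re_le_norm (z - 2)
    simp only [Complex.sub_re, Complex.re_ofNat] at this
    linarith
  constructor <;> linarith [abs_le.mp h4]

theorem isUnit_smul_freeHamiltonian_add {a b : ℂ}
    (h : ∀ c ∈ Set.Icc (0 : ℝ) 4, a * c + b ≠ 0) :
    IsUnit (a • freeHamiltonian + b • (1 : ellTwo →L[ℂ] ellTwo)) := by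
  rcases eq_or_ne a 0 with rfl | ha
  · have hb : b ≠ 0 := by simpa using h 0 (by simp)
    simpa using (isUnit_one (M := ellTwo →L[ℂ] ellTwo)).smul (Units.mk0 b hb)
  · have hn : -b / a ∉ spectrum ℂ freeHamiltonian := fun hs => by
      obtain ⟨c, hc, hbc⟩ := mem_Icc_of_mem_spectrum_freeHamiltonian hs
      refine h c hc ?_
      rw [← hbc]
      field_simp
      ring
    have hu := (spectrum.notMem_iff.mp hn).smul (Units.mk0 (-a) (neg_ne_zero.mpr ha))
    convert! hu using 1
    rw [Units.smul_def, Units.val_mk0, Algebra.algebraMap_eq_smul_one, smul_sub, smul_smul]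
    have : -a * (-b / a) = b := by field_simp
    rw [this]
    module

/-- The conjugated free pencil `4 e^{2θ} H₀ - z (e^{2θ} H₀ + e^{-2θ} (4 - H₀))`. -/
def freePencil (θ z : ℂ) : ellTwo →L[ℂ] ellTwo :=
  (4 * Complex.exp (2 * θ)) • freeHamiltonian - z • dilationDenom freeHamiltonian θ

theorem isUnit_dilationDenom {θ : ℂ} (hθ : |θ.im| < 1 / 4) :
    IsUnit (dilationDenom freeHamiltonian θ) := by
  have h := isUnit_smul_freeHamiltonian_add
    (a := Complex.exp (2 * θ) - Complex.exp (-(2 * θ))) (b := 4 * Complex.exp (-(2 * θ))) ?_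
  · convert! h using 1
    rw [dilationDenom]
    module
  · intro c hc h0
    have hcos : 0 < Real.cos (2 * θ.im) := by
      apply Real.cos_pos_of_mem_Ioo
      constructor <;> linarith [abs_lt.mp hθ, Real.pi_gt_three]
    have h1 := congrArg Complex.re h0
    simp only [Complex.add_re, Complex.mul_re, Complex.sub_re, Complex.exp_re, Complex.ofReal_re,
      Complex.ofReal_im, Complex.neg_re, Complex.neg_im, Complex.re_ofNat, Complex.im_ofNat,
      zero_mul, sub_zero, mul_zero, Complex.zero_re, Complex.mul_im, add_zero,
      Real.cos_neg] at h1
    have e1 := mul_pos (Real.exp_pos (2 * θ.re)) hcos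
    have e2 := mul_pos (Real.exp_pos (-(2 * θ.re))) hcos
    rcases eq_or_lt_of_le hc.1 with hc0 | hc0
    · rw [← hc0] at h1; linarith
    · nlinarith [mul_pos e1 hc0, mul_nonneg e2.le (sub_nonneg.mpr hc.2)]

/-- Multiplication by `q` turns the ray `{c / (4 - c) : 0 ≤ c ≤ 4}` away from the half-plane
containing `z / (4 - z)`. -/
theorem mul_four_sub_mul_ne {q z : ℂ} {s c : ℝ} (hc : c ∈ Set.Icc (0 : ℝ) 4) (hq : q ≠ 0)
    (hz0 : z ≠ 0) (hz4 : z ≠ 4) (hqs : s * q.im ≤ 0) (hzs : 0 ≤ s * z.im)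
    (hlt : s * q.im < 0 ∨ 0 < s * z.im) : q * (4 - z) * c ≠ z * (4 - c) := by
  intro h
  have h4z : (4 : ℂ) - z ≠ 0 := sub_ne_zero.mpr hz4.symm
  have hpos : 0 < Complex.normSq (4 - z) := Complex.normSq_pos.mpr h4z
  have hkey : s * q.im * c * Complex.normSq (4 - z) = 4 * (4 - c) * (s * z.im) := by
    have hre := congrArg Complex.re h
    have him := congrArg Complex.im h
    simp only [Complex.mul_re, Complex.mul_im, Complex.sub_re, Complex.sub_im, Complex.re_ofNat,
      Complex.im_ofNat, Complex.ofReal_re, Complex.ofReal_im, mul_zero, sub_zero, zero_sub,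
      zero_add, sub_self] at hre him
    rw [Complex.normSq_apply]
    simp only [Complex.sub_re, Complex.sub_im, Complex.re_ofNat, Complex.im_ofNat, zero_sub]
    linear_combination (s * (4 - z.re)) * him + s * z.im * hre
  have hl : s * q.im * c * Complex.normSq (4 - z) ≤ 0 :=
    mul_nonpos_of_nonpos_of_nonneg (mul_nonpos_of_nonpos_of_nonneg hqs hc.1) hpos.le
  have hr : 0 ≤ 4 * (4 - c) * (s * z.im) := by
    have := hc.2
    exact mul_nonneg (by linarith) hzs
  rcases hlt with hlt | hlt
  · have h0 : s * q.im * c * Complex.normSq (4 - z) = 0 := by linarith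
    have hc0 : c = 0 :=
      (mul_eq_zero.mp ((mul_eq_zero.mp h0).resolve_right hpos.ne')).resolve_left hlt.ne
    rw [hc0] at h
    simp [hz0] at h
  · have h0 : 4 * (4 - c) * (s * z.im) = 0 := by linarith
    have hc4 : c = 4 := by
      have := (mul_eq_zero.mp h0).resolve_right hlt.ne'
      linarith
    rw [hc4] at h
    simp [hq, h4z] at h

/-- With `s = ±1` selecting a half-plane for `z` and the opposite one for `θ`, the free pencil is
invertible unless `θ` and `z` are both real or `z` is a threshold. -/
theorem isUnit_freePencil {θ z : ℂ} {s : ℝ} (hs : s = 1 ∨ s = -1) (hθ : |θ.im| < 1 / 4)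
    (hz0 : z ≠ 0) (hz4 : z ≠ 4) (hθs : s * θ.im ≤ 0) (hzs : 0 ≤ s * z.im)
    (hlt : s * θ.im < 0 ∨ 0 < s * z.im) : IsUnit (freePencil θ z) := by
  have h := isUnit_smul_freeHamiltonian_add
    (a := 4 * Complex.exp (2 * θ) - z * (Complex.exp (2 * θ) - Complex.exp (-(2 * θ))))
    (b := -(z * (4 * Complex.exp (-(2 * θ))))) ?_
  · convert! h using 1
    rw [freePencil, dilationDenom]
    module
  · intro c hc h0
    have him : (Complex.exp (4 * θ)).im = Real.exp (4 * θ.re) * Real.sin (4 * θ.im) := by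
      simp [Complex.exp_im]
    have hsin : s * Real.sin (4 * θ.im) = Real.sin (4 * (s * θ.im)) := by
      rcases hs with rfl | rfl <;> simp
    have hsθ : -(1 / 4) < s * θ.im := by
      rcases hs with rfl | rfl <;> linarith [abs_lt.mp hθ]
    have himeq : s * (Complex.exp (4 * θ)).im =
        Real.exp (4 * θ.re) * Real.sin (4 * (s * θ.im)) := by
      rw [him, ← hsin]; ring
    refine mul_four_sub_mul_ne (q := Complex.exp (4 * θ)) (s := s) hc (Complex.exp_ne_zero _)
      hz0 hz4 ?_ hzs ?_ ?_
    · rw [himeq]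
      refine mul_nonpos_of_nonneg_of_nonpos (Real.exp_pos _).le ?_
      exact Real.sin_nonpos_of_nonpos_of_neg_pi_le (by linarith) (by linarith [Real.pi_gt_three])
    · refine hlt.imp (fun h => ?_) id
      rw [himeq]
      refine mul_neg_of_pos_of_neg (Real.exp_pos _) ?_
      exact Real.sin_neg_of_neg_of_neg_pi_lt (by linarith) (by linarith [Real.pi_gt_three])
    · have e1 : Complex.exp (4 * θ) = Complex.exp (2 * θ) * Complex.exp (2 * θ) := by
        rw [← Complex.exp_add]; ring_nf
      have e2 : Complex.exp (2 * θ) * Complex.exp (-(2 * θ)) = 1 := by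
        rw [← Complex.exp_add]; simp
      rw [e1]
      linear_combination Complex.exp (2 * θ) * h0 + (z * (4 - c)) * e2

/-! ### The interval `(0, 4)` belongs to the spectrum of every compact perturbation -/

/-- A decaying solution of the three-term recurrence with `|s| < 2` vanishes: the quadratic form
`|a n|² + |a (n + 1)|² - s Re (conj (a n) a (n + 1))` is positive definite and conserved. -/
theorem eq_zero_of_recurrence {a : ℕ → ℂ} {s : ℝ} (hs : |s| < 2)
    (hrec : ∀ n, a (n + 2) = s * a (n + 1) - a n) (hlim : Tendsto a atTop (𝓝 0)) (n : ℕ) :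
    a n = 0 := by
  set e : ℕ → ℝ := fun n => (a n).re ^ 2 + (a (n + 1)).re ^ 2 - s * (a n).re * (a (n + 1)).re
    + ((a n).im ^ 2 + (a (n + 1)).im ^ 2 - s * (a n).im * (a (n + 1)).im) with he
  have hstep : ∀ n, e (n + 1) = e n := fun n => by
    simp only [he, add_assoc, Nat.reduceAdd, hrec]
    simp only [Complex.sub_re, Complex.sub_im, Complex.re_ofReal_mul, Complex.im_ofReal_mul]
    ring
  have hconst : ∀ n, e n = e 0 := fun n => by
    induction n with
    | zero => rfl
    | succ k ih => rw [hstep, ih]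
  have hre : Tendsto (fun n => (a n).re) atTop (𝓝 0) := by
    simpa using! (Complex.continuous_re.tendsto 0).comp hlim
  have him : Tendsto (fun n => (a n).im) atTop (𝓝 0) := by
    simpa using! (Complex.continuous_im.tendsto 0).comp hlim
  have hre' := hre.comp (tendsto_add_atTop_nat 1)
  have him' := him.comp (tendsto_add_atTop_nat 1)
  have helim : Tendsto e atTop (𝓝 0) := by
    have := (((hre.pow 2).add (hre'.pow 2)).sub ((hre.const_mul s).mul hre')).add
      (((him.pow 2).add (him'.pow 2)).sub ((him.const_mul s).mul him'))
    simpa using! this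
  have he0 : e n = 0 := by
    rw [hconst n]
    refine tendsto_nhds_unique ?_ helim
    rw [funext hconst]
    exact tendsto_const_nhds
  have hs2 : s ^ 2 < 4 := by
    nlinarith [sq_abs s, abs_nonneg s]
  have hform : ∀ p q : ℝ, (1 - s ^ 2 / 4) * p ^ 2 ≤ p ^ 2 + q ^ 2 - s * p * q := fun p q => by
    nlinarith [sq_nonneg (q - s / 2 * p)]
  have h1 := hform (a n).re (a (n + 1)).re
  have h2 := hform (a n).im (a (n + 1)).im
  have hk : 0 < 1 - s ^ 2 / 4 := by linarith
  have hsum : (1 - s ^ 2 / 4) * (a n).re ^ 2 + (1 - s ^ 2 / 4) * (a n).im ^ 2 ≤ 0 := by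
    simp only [he] at he0
    linarith
  have p1 := mul_nonneg hk.le (sq_nonneg (a n).re)
  have p2 := mul_nonneg hk.le (sq_nonneg (a n).im)
  have q1 : (a n).re ^ 2 = 0 := (mul_eq_zero.mp (by linarith)).resolve_left hk.ne'
  have q2 : (a n).im ^ 2 = 0 := (mul_eq_zero.mp (by linarith)).resolve_left hk.ne'
  exact Complex.ext (by simpa using q1) (by simpa using q2)

theorem tendsto_cofinite_zero (x : ellTwo) : Tendsto (fun n : ℤ => x n) cofinite (𝓝 0) := by
  have h := (lp.memℓp x).summable (by norm_num)
  have h2 := h.tendsto_cofinite_zero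
  rw [tendsto_zero_iff_norm_tendsto_zero]
  have h3 := (Real.continuous_sqrt.tendsto 0).comp h2
  rw [Real.sqrt_zero] at h3
  refine h3.congr fun n => ?_
  simp [Real.sqrt_sq]

/-- A square-summable solution of `(H₀ - w) x = 0` off the origin vanishes, for `0 < w < 4`. -/
theorem eq_zero_of_freeHamiltonian_apply_eq {x : ellTwo} {w : ℝ} (hw0 : 0 < w) (hw4 : w < 4)
    (h : ∀ n : ℤ, n ≠ 0 → freeHamiltonian x n = w * x n) : x = 0 := by
  have hs : |2 - w| < 2 := abs_lt.mpr ⟨by linarith, by linarith⟩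
  have hpos : ∀ n : ℕ, x n = 0 := by
    refine eq_zero_of_recurrence hs (fun n => ?_)
      ((tendsto_cofinite_zero x).comp (Nat.cast_injective.tendsto_cofinite.mono_left
        Nat.cofinite_eq_atTop.ge))
    have := h (n + 1) (by omega)
    rw [freeHamiltonian_apply, show (n : ℤ) + 1 + 1 = n + 2 by ring,
      show (n : ℤ) + 1 - 1 = n by ring] at this
    push_cast
    rw [add_assoc (n : ℤ), one_add_one_eq_two]
    linear_combination -this
  have hneg : ∀ n : ℕ, x (-n) = 0 := by
    refine eq_zero_of_recurrence (a := fun n : ℕ => x (-n)) hs (fun n => ?_)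
      ((tendsto_cofinite_zero x).comp
        ((neg_injective.comp Nat.cast_injective).tendsto_cofinite.mono_left Nat.cofinite_eq_atTop.ge))
    have := h (-(n + 1)) (by omega)
    rw [freeHamiltonian_apply, show -((n : ℤ) + 1) + 1 = -n by ring,
      show -((n : ℤ) + 1) - 1 = -(n + 2) by ring] at this
    push_cast
    rw [add_assoc (n : ℤ), one_add_one_eq_two]
    linear_combination -this
  ext n
  obtain ⟨k, rfl | rfl⟩ := n.eq_nat_or_neg
  · exact hpos k
  · exact hneg k

theorem not_surjective_freeHamiltonian_sub {w : ℝ} (hw0 : 0 < w) (hw4 : w < 4) :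
    ¬ Function.Surjective (freeHamiltonian - (w : ℂ) • (1 : ellTwo →L[ℂ] ellTwo)) := by
  intro hsurj
  obtain ⟨x, hx⟩ := hsurj (lp.single 2 (0 : ℤ) (1 : ℂ))
  have hxn : ∀ n : ℤ, freeHamiltonian x n - w * x n = lp.single (E := fun _ : ℤ => ℂ) 2 0 1 n :=
    fun n => congrArg (fun y : ellTwo => y n) hx
  have hx0 : x = 0 := by
    refine eq_zero_of_freeHamiltonian_apply_eq hw0 hw4 fun n hn => ?_
    have := hxn n
    rw [lp.single_apply_ne (E := fun _ : ℤ => ℂ) 2 0 1 hn] at this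
    exact sub_eq_zero.mp this
  have := hxn 0
  rw [hx0, lp.single_apply_self] at this
  simp at this

theorem mem_spectrum_freeHamiltonian_add {V : ellTwo →L[ℂ] ellTwo} (hV : IsCompactOperator V)
    {w : ℝ} (hw0 : 0 < w) (hw4 : w < 4) : (w : ℂ) ∈ spectrum ℂ (freeHamiltonian + V) := by
  by_contra hn
  have hu := spectrum.notMem_iff.mp hn
  set B := algebraMap ℂ (ellTwo →L[ℂ] ellTwo) w - (freeHamiltonian + V) with hB
  have hBV : B * (Ring.inverse B * V) = V := by
    rw [← mul_assoc, Ring.mul_inverse_cancel _ hu, one_mul]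
  have hfree : freeHamiltonian - (w : ℂ) • (1 : ellTwo →L[ℂ] ellTwo)
      = B * (-1 - Ring.inverse B * V) := by
    rw [mul_sub, hBV, hB, Algebra.algebraMap_eq_smul_one]
    noncomm_ring
  have hcomp : IsCompactOperator (Ring.inverse B * V : ellTwo →L[ℂ] ellTwo) := hV.clm_comp _
  rcases hcomp.hasEigenvalue_or_mem_resolventSet (μ := -1) (by norm_num) with h | h
  · obtain ⟨v, hv⟩ := h.exists_hasEigenvector
    refine hv.2 (eq_zero_of_freeHamiltonian_apply_eq hw0 hw4 fun n _ => ?_)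
    have h1 : (Ring.inverse B * V) v = (-1 : ℂ) • v := hv.apply_eq_smul
    have h2 := congrArg (fun T : ellTwo →L[ℂ] ellTwo => T v) hfree
    have h3 : (B * (-1 - Ring.inverse B * V)) v = 0 := by
      change B (-v - (Ring.inverse B * V) v) = 0
      rw [h1]
      simp
    simp only [h3] at h2
    have h4 : freeHamiltonian v n - w * v n = 0 := congrArg (fun y : ellTwo => y n) h2
    exact sub_eq_zero.mp h4
  · have h1 : IsUnit (freeHamiltonian - (w : ℂ) • (1 : ellTwo →L[ℂ] ellTwo)) := by
      rw [hfree]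
      refine hu.mul ?_
      have := spectrum.mem_resolventSet_iff.mp h
      simpa using this
    exact not_surjective_freeHamiltonian_sub hw0 hw4
      (ContinuousLinearMap.isUnit_iff_bijective.mp h1).2

/-- Points of `(0, 4)` are not isolated in the spectrum of `H₀ + V`. -/
theorem notMem_discreteSpectrum {V : ellTwo →L[ℂ] ellTwo} (hV : IsCompactOperator V)
    {w : ℝ} (hw0 : 0 < w) (hw4 : w < 4) : (w : ℂ) ∉ discreteSpectrum (freeHamiltonian + V) := by
  rintro ⟨-, r, hr, hiso, -⟩
  set ε := min r ((4 - w) / 2) with hε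
  have hε0 : 0 < ε := lt_min hr (by linarith)
  have hmem : ((w + ε : ℝ) : ℂ) ∈
      spectrum ℂ (freeHamiltonian + V) ∩ Metric.closedBall (w : ℂ) r := by
    refine ⟨mem_spectrum_freeHamiltonian_add hV (by linarith) ?_, ?_⟩
    · linarith [min_le_right r ((4 - w) / 2)]
    · rw [Metric.mem_closedBall, Complex.dist_eq]
      push_cast
      rw [add_sub_cancel_left, Complex.norm_real, Real.norm_of_nonneg hε0.le]
      exact min_le_left _ _
  rw [hiso, Set.mem_singleton_iff, Complex.ofReal_inj] at hmem
  linarith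

/-! ### Accumulation of the spectrum -/

theorem differentiable_dilationDenom : Differentiable ℂ (dilationDenom freeHamiltonian) := by
  unfold dilationDenom
  fun_prop

theorem differentiable_freePencil_left (z : ℂ) : Differentiable ℂ fun θ => freePencil θ z := by
  unfold freePencil
  exact Differentiable.sub (by fun_prop) (differentiable_dilationDenom.const_smul z)

theorem differentiable_freePencil_right (θ : ℂ) : Differentiable ℂ (freePencil θ) := by
  unfold freePencil
  fun_prop

theorem exists_ball_isUnit {L : ℂ → ellTwo →L[ℂ] ellTwo} (hL : Differentiable ℂ L) {z : ℂ}
    (hz : IsUnit (L z)) {ρ : ℝ} (hρ : 0 < ρ) :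
    ∃ δ : ℝ, 0 < δ ∧ δ ≤ ρ ∧ ∀ w ∈ Metric.ball z δ, IsUnit (L w) := by
  obtain ⟨δ, hδ, h⟩ := Metric.eventually_nhds_iff_ball.mp
    (hL.continuous.continuousAt.eventually (Units.isOpen.mem_nhds hz))
  exact ⟨min δ ρ, lt_min hδ hρ, min_le_right _ _,
    fun w hw => h w (Metric.ball_subset_ball (min_le_left _ _) hw)⟩

theorem convex_setOf_mul_im_pos (s : ℝ) : Convex ℝ {z : ℂ | 0 < s * z.im} :=
  convex_halfSpace_gt ⟨fun z w => by simp [mul_add], fun c z => by simp; ring⟩ 0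

theorem isOpen_setOf_mul_im_pos (s : ℝ) : IsOpen {z : ℂ | 0 < s * z.im} :=
  isOpen_lt continuous_const (by fun_prop)

/-- A convex set cut by a half-plane, together with a ball about a boundary point of the half-plane,
is connected. -/
theorem isPreconnected_halfPlane_inter_union_ball {s : ℝ} (hs : s = 1 ∨ s = -1) {C : Set ℂ}
    (hC : Convex ℝ C) {x δ : ℝ} (hδ : 0 < δ) (hball : Metric.ball (x : ℂ) δ ⊆ C) :
    IsPreconnected (C ∩ {z : ℂ | 0 < s * z.im} ∪ Metric.ball (x : ℂ) δ) := by
  have hmem : (x : ℂ) + s * (δ / 2 : ℝ) * Complex.I ∈ Metric.ball (x : ℂ) δ := by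
    rw [Metric.mem_ball, Complex.dist_eq, add_sub_cancel_left]
    have : ‖(s : ℂ) * (δ / 2 : ℝ) * Complex.I‖ = δ / 2 := by
      rw [norm_mul, norm_mul, Complex.norm_I, Complex.norm_real, Complex.norm_real,
        Real.norm_of_nonneg (by linarith : 0 ≤ δ / 2)]
      rcases hs with rfl | rfl <;> simp
    rw [this]
    linarith
  refine IsPreconnected.union _ ⟨hball hmem, ?_⟩ hmem
    (hC.inter (convex_setOf_mul_im_pos s)).isPreconnected (convex_ball _ _).isPreconnected
  rcases hs with rfl | rfl <;> simp [hδ]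

section Perturbation

variable {V : ellTwo →L[ℂ] ellTwo}

/-- Off `[0, 4]` the spectrum of `H₀ + V` does not accumulate. -/
theorem exists_mem_Icc_of_frequently_mem_spectrum (hV : IsCompactOperator V) {z₀ : ℂ}
    (hf : ∃ᶠ z in 𝓝[≠] z₀, z ∈ spectrum ℂ (freeHamiltonian + V)) :
    ∃ c ∈ Set.Icc (0 : ℝ) 4, z₀ = c := by
  by_contra hz₀
  set P : Set ℂ := {z | 0 < (1 : ℝ) * z.im} with hP
  set N : Set ℂ := {z | 0 < (-1 : ℝ) * z.im} with hN
  set A : Set ℂ := {z | z.re < 0} with hA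
  set B : Set ℂ := {z | 4 < z.re} with hB
  set Ω : Set ℂ := (A ∪ P) ∪ (B ∪ N) with hΩ
  have hmem : ∀ z : ℂ, z ∈ Ω ↔ ¬ ∃ c ∈ Set.Icc (0 : ℝ) 4, z = c := by
    intro z
    constructor
    · rintro h ⟨c, hc, rfl⟩
      simp only [hΩ, hA, hB, hP, hN, Set.mem_union, Set.mem_ofPred_eq, Complex.ofReal_re,
        Complex.ofReal_im, mul_zero, lt_irrefl, or_false] at h
      rcases h with h | h
      · linarith [hc.1]
      · linarith [hc.2]
    · intro h
      by_contra hn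
      simp only [hΩ, hA, hB, hP, hN, Set.mem_union, Set.mem_ofPred_eq, not_or, not_lt] at hn
      exact h ⟨z.re, ⟨hn.1.1, hn.2.1⟩, Complex.ext rfl (by
        rw [Complex.ofReal_im]; linarith [hn.1.2, hn.2.2])⟩
  have hopen : IsOpen Ω := by
    refine IsOpen.union (IsOpen.union ?_ (isOpen_setOf_mul_im_pos _))
      (IsOpen.union ?_ (isOpen_setOf_mul_im_pos _))
    · exact isOpen_lt Complex.continuous_re continuous_const
    · exact isOpen_lt continuous_const Complex.continuous_re
  have hconn : IsPreconnected Ω := by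
    have hcA : IsPreconnected A := (convex_halfSpace_re_lt 0).isPreconnected
    have hcB : IsPreconnected B := (convex_halfSpace_re_gt 4).isPreconnected
    have hcP : IsPreconnected P := (convex_setOf_mul_im_pos 1).isPreconnected
    have hcN : IsPreconnected N := (convex_setOf_mul_im_pos (-1)).isPreconnected
    refine IsPreconnected.union ⟨-1, -1⟩ (by simp [hA]) (by simp [hN]) ?_ ?_
    · exact hcA.union ⟨-1, 1⟩ (by simp [hA]) (by simp [hP]) hcP
    · exact hcB.union ⟨5, -1⟩ (by simp [hB]; norm_num) (by simp [hN]) hcN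
  have hL : Differentiable ℂ fun z : ℂ =>
      algebraMap ℂ (ellTwo →L[ℂ] ellTwo) z - freeHamiltonian := by
    simp only [Algebra.algebraMap_eq_smul_one]
    fun_prop
  have hsum : ∀ z : ℂ, algebraMap ℂ (ellTwo →L[ℂ] ellTwo) z - freeHamiltonian + -V
      = algebraMap ℂ (ellTwo →L[ℂ] ellTwo) z - (freeHamiltonian + V) := fun z => by abel
  have hall := not_isUnit_of_frequently_not_isUnit hopen hconn hL.differentiableOn
    (differentiableOn_const (c := -V))
    (fun z hz => spectrum.notMem_iff.mp fun h =>
      (hmem z).mp hz (mem_Icc_of_mem_spectrum_freeHamiltonian h))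
    (fun _ _ => hV.neg) ((hmem z₀).mpr hz₀)
    (hf.mono fun z hz => by rw [hsum]; exact spectrum.mem_iff.mp hz)
  set t : ℝ := ‖freeHamiltonian + V‖ + 1 with ht
  have htpos : 0 < t := by positivity
  refine hall (-t : ℝ) (Or.inl (Or.inl (by simpa [hA] using htpos))) ?_
  rw [hsum]
  refine spectrum.notMem_iff.mp fun h => ?_
  have h1 := (spectrum.norm_le_norm_mul_of_mem h).trans
    (mul_le_of_le_one_right (norm_nonneg _) ContinuousLinearMap.norm_id_le)
  rw [Complex.norm_real, norm_neg, Real.norm_of_nonneg htpos.le] at h1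
  linarith

/-- At points `λ` of `(0, 4)` the spectrum of `H₀ + V` does not accumulate from either half-plane.
For real `θ` the pencil below is `e^{iθA₀} (H₀ + V - z) e^{-iθA₀}` times an invertible operator, so
a spectral point `z` in the half-plane persists, by analyticity in `θ`, to a non-real `θ` for which
the free pencil stays invertible across the interval `(0, 4)`; there the analytic Fredholm theorem
applies in the variable `z`. -/
theorem not_frequently_mem_spectrum_halfPlane (hV : IsCompactOperator V)
    (hanalytic : MemAnalyticClass conjugateOperator V) {s : ℝ} (hs : s = 1 ∨ s = -1) {x : ℝ}
    (hx0 : 0 < x) (hx4 : x < 4) :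
    ¬ ∃ᶠ z in 𝓝[≠] (x : ℂ), z ∈ spectrum ℂ (freeHamiltonian + V) ∧ 0 < s * z.im := by
  intro hf
  obtain ⟨R, hR, U, hU, F, hF, hFU⟩ := hanalytic
  set D := dilationDenom freeHamiltonian with hD
  set ρ : ℝ := min R (1 / 4) with hρ
  have hρ0 : 0 < ρ := lt_min hR (by norm_num)
  have hballR : Metric.ball (0 : ℂ) ρ ⊆ Metric.ball 0 R :=
    Metric.ball_subset_ball (min_le_left _ _)
  have him : ∀ θ ∈ Metric.ball (0 : ℂ) ρ, |θ.im| < 1 / 4 := fun θ hθ => by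
    have h1 : ‖θ‖ < ρ := by simpa using hθ
    exact (Complex.abs_im_le_norm θ).trans_lt (h1.trans_le (min_le_right _ _))
  have hs' : -s = 1 ∨ -s = -1 := by rcases hs with rfl | rfl <;> simp
  have hss : s * s = 1 := by rcases hs with rfl | rfl <;> norm_num
  have hFc : ∀ θ ∈ Metric.ball (0 : ℂ) ρ, IsCompactOperator (F θ * D θ : ellTwo →L[ℂ] ellTwo) :=
    fun θ hθ => (isCompactOperator_of_forall_real hR hF
      (fun t ht => by rw [hFU t ht]; exact (hV.clm_comp (U t)).comp_clm (U (-t)))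
      (hballR hθ)).comp_clm (D θ)
  have hne : ∀ z : ℂ, 0 < s * z.im → z ≠ 0 ∧ z ≠ 4 := fun z hz =>
    ⟨by rintro rfl; simp at hz, by rintro rfl; simp at hz⟩
  -- For real `θ` the pencil is unitarily equivalent to `H₀ + V - z`, up to the factor `D θ`.
  have hreal : ∀ θ : ℝ, |θ| < R → ∀ z ∈ spectrum ℂ (freeHamiltonian + V),
      ¬ IsUnit (freePencil θ z + F θ * D θ) := by
    intro θ hθ z hz hunit
    have hDu : IsUnit (D θ) := isUnit_dilationDenom (by simp)
    have hfac : freePencil θ z + F θ * D θ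
        = U θ * (-(algebraMap ℂ (ellTwo →L[ℂ] ellTwo) z - (freeHamiltonian + V))) * U (-θ)
          * D θ := by
      rw [freePencil, hFU θ hθ, ← logisticCommutator_freeHamiltonian.conj_mul_dilationDenom
        dense_conjugateOperator_domain hU θ, Algebra.algebraMap_eq_smul_one]
      have h1 : U θ * (z • (1 : ellTwo →L[ℂ] ellTwo)) * U (-θ) = z • 1 := by
        rw [mul_smul_comm, mul_one, smul_mul_assoc, hU.mul_neg]
      have h2 : z • D θ = U θ * (z • (1 : ellTwo →L[ℂ] ellTwo)) * U (-θ) * D θ := by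
        rw [h1, smul_mul_assoc, one_mul]
      change _ - z • D θ + _ = _
      rw [h2]
      noncomm_ring
    refine spectrum.mem_iff.mp hz ?_
    obtain ⟨a, ha⟩ := hU.isUnit θ
    obtain ⟨b, hb⟩ := hU.isUnit (-θ)
    obtain ⟨d, hd⟩ := hDu
    rw [hfac, ← ha, ← hb, ← hd, Units.isUnit_mul_units, Units.isUnit_mul_units,
      Units.isUnit_units_mul, IsUnit.neg_iff] at hunit
    exact hunit
  -- Persistence of a spectral point from real to complex `θ`.
  have hpersist : ∀ z ∈ spectrum ℂ (freeHamiltonian + V), 0 < s * z.im →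
      ∀ θ ∈ Metric.ball (0 : ℂ) ρ, s * θ.im < 0 → ¬ IsUnit (freePencil θ z + F θ * D θ) := by
    intro z hz hzs θ hθ hθs
    obtain ⟨hz0, hz4⟩ := hne z hzs
    obtain ⟨δ, hδ, hδρ, hδu⟩ := exists_ball_isUnit (differentiable_freePencil_left z) (z := 0)
      (isUnit_freePencil hs (by simp) hz0 hz4 (by simp) hzs.le (Or.inr hzs)) hρ0
    set Ω := Metric.ball (0 : ℂ) ρ ∩ {θ : ℂ | 0 < -s * θ.im} ∪ Metric.ball ((0 : ℝ) : ℂ) δ with hΩ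
    have hδsub : Metric.ball ((0 : ℝ) : ℂ) δ ⊆ Metric.ball (0 : ℂ) ρ := by
      rw [Complex.ofReal_zero]
      exact Metric.ball_subset_ball hδρ
    have hΩsub : Ω ⊆ Metric.ball (0 : ℂ) ρ := Set.union_subset Set.inter_subset_left hδsub
    have hΩopen : IsOpen Ω :=
      (Metric.isOpen_ball.inter (isOpen_setOf_mul_im_pos (-s))).union Metric.isOpen_ball
    refine not_isUnit_of_frequently_not_isUnit hΩopen
      (isPreconnected_halfPlane_inter_union_ball hs' (convex_ball 0 ρ) hδ hδsub)
      (L := fun θ => freePencil θ z) (K := fun θ => F θ * D θ) (z₀ := 0)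
      (differentiable_freePencil_left z).differentiableOn
      ((hF.mono (hΩsub.trans hballR)).mul differentiable_dilationDenom.differentiableOn)
      ?_ (fun w hw => hFc w (hΩsub hw)) (Or.inr (by simpa using hδ)) ?_ θ
      (Or.inl ⟨hθ, by simpa using hθs⟩)
    · rintro w (⟨hw, hws⟩ | hw)
      · have hws' : 0 < -s * w.im := hws
        exact isUnit_freePencil hs (him w hw) hz0 hz4 (by linarith) hzs.le (Or.inr hzs)
      · exact hδu w (by simpa using hw)
    · refine tendsto_ofReal_nhdsNE_zero.frequently (Eventually.frequently ?_)
      filter_upwards [nhdsWithin_le_nhds (Metric.ball_mem_nhds (0 : ℝ) hR)] with t ht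
      exact hreal t (by simpa using ht) z hz
  -- The analytic Fredholm theorem in `z`, at a fixed non-real `θ₁`.
  set θ₁ : ℂ := (-(s * (ρ / 2)) : ℝ) * Complex.I with hθ₁
  have hθ₁im : θ₁.im = -(s * (ρ / 2)) := by simp [hθ₁]
  have hθ₁s : s * θ₁.im < 0 := by
    rw [hθ₁im]
    have : s * -(s * (ρ / 2)) = -(ρ / 2) := by linear_combination (-(ρ / 2)) * hss
    linarith
  have hθ₁mem : θ₁ ∈ Metric.ball (0 : ℂ) ρ := by
    rw [mem_ball_zero_iff, hθ₁, norm_mul, Complex.norm_I, mul_one, Complex.norm_real, norm_neg,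
      norm_mul, Real.norm_of_nonneg (by linarith : 0 ≤ ρ / 2)]
    rcases hs with rfl | rfl <;> simp [hρ0]
  have hx0' : (x : ℂ) ≠ 0 := by exact_mod_cast hx0.ne'
  have hx4' : (x : ℂ) ≠ 4 := by exact_mod_cast hx4.ne
  obtain ⟨δ, hδ, -, hδu⟩ := exists_ball_isUnit (differentiable_freePencil_right θ₁) (z := x)
    (isUnit_freePencil hs (him θ₁ hθ₁mem) hx0' hx4' hθ₁s.le (by simp) (Or.inl hθ₁s)) one_pos
  have hall : ∀ z ∈ Set.univ ∩ {z : ℂ | 0 < s * z.im} ∪ Metric.ball (x : ℂ) δ,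
      ¬ IsUnit (freePencil θ₁ z + F θ₁ * D θ₁) := by
    refine not_isUnit_of_frequently_not_isUnit
      ((isOpen_univ.inter (isOpen_setOf_mul_im_pos s)).union Metric.isOpen_ball)
      (isPreconnected_halfPlane_inter_union_ball hs convex_univ hδ (Set.subset_univ _))
      (L := fun z => freePencil θ₁ z) (K := fun _ => F θ₁ * D θ₁) (z₀ := x)
      (differentiable_freePencil_right θ₁).differentiableOn (differentiableOn_const _)
      ?_ (fun _ _ => hFc θ₁ hθ₁mem) (Or.inr (Metric.mem_ball_self hδ)) ?_
    · rintro z (⟨-, hz⟩ | hz)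
      · have hz' : 0 < s * z.im := hz
        exact isUnit_freePencil hs (him θ₁ hθ₁mem) (hne z hz').1 (hne z hz').2 hθ₁s.le hz'.le
          (Or.inr hz')
      · exact hδu z hz
    · exact hf.mono fun z hz => hpersist z hz.1 hz.2 θ₁ hθ₁mem hθ₁s
  -- Far away in the half-plane the pencil is `(M - z) D` with `M` bounded, which is invertible.
  have hDu : IsUnit (D θ₁) := isUnit_dilationDenom (him θ₁ hθ₁mem)
  set M := ((4 * Complex.exp (2 * θ₁)) • freeHamiltonian + F θ₁ * D θ₁) * Ring.inverse (D θ₁)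
    with hM
  set t : ℝ := ‖M‖ + 1 with ht
  have htpos : 0 < t := by positivity
  set z : ℂ := (s * t : ℝ) * Complex.I with hz
  have hzim : s * z.im = t := by
    have : z.im = s * t := by simp [hz]
    rw [this]
    linear_combination t * hss
  refine hall z (Or.inl ⟨trivial, ?_⟩) ?_
  · change 0 < s * z.im
    rw [hzim]
    exact htpos
  · have hfac : freePencil θ₁ z + F θ₁ * D θ₁
        = -(algebraMap ℂ (ellTwo →L[ℂ] ellTwo) z - M) * D θ₁ := by
      have hMD : M * D θ₁ = (4 * Complex.exp (2 * θ₁)) • freeHamiltonian + F θ₁ * D θ₁ := by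
        rw [hM, mul_assoc, Ring.inverse_mul_cancel _ hDu, mul_one]
      rw [neg_sub, sub_mul, hMD, Algebra.algebraMap_eq_smul_one, smul_mul_assoc, one_mul,
        freePencil]
      abel
    rw [hfac]
    refine IsUnit.mul (IsUnit.neg (spectrum.notMem_iff.mp fun h => ?_)) hDu
    have h1 := (spectrum.norm_le_norm_mul_of_mem h).trans
      (mul_le_of_le_one_right (norm_nonneg _) ContinuousLinearMap.norm_id_le)
    have h2 : t ≤ ‖z‖ := by
      rw [← hzim]
      refine (le_abs_self _).trans ?_
      rw [abs_mul]
      have : |s| = 1 := by rcases hs with rfl | rfl <;> simp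
      rw [this, one_mul]
      exact Complex.abs_im_le_norm z
    linarith

theorem eq_zero_or_eq_four_of_frequently_mem_discreteSpectrum (hcompact : IsCompactOperator V)
    (hanalytic : MemAnalyticClass conjugateOperator V) {z : ℂ}
    (hfreq : ∃ᶠ w in 𝓝[≠] z, w ∈ discreteSpectrum (freeHamiltonian + V)) : z = 0 ∨ z = 4 := by
  obtain ⟨c, hc, rfl⟩ := exists_mem_Icc_of_frequently_mem_spectrum hcompact
    (hfreq.mono fun w hw => hw.1)
  by_contra hne
  have hc0 : 0 < c := lt_of_le_of_ne hc.1 fun h => hne (Or.inl (by rw [← h]; simp))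
  have hc4 : c < 4 := lt_of_le_of_ne hc.2 fun h => hne (Or.inr (by rw [h]; simp))
  have hnear : ∀ᶠ w in 𝓝[≠] (c : ℂ), 0 < w.re ∧ w.re < 4 := by
    have h : ∀ᶠ w in 𝓝 (c : ℂ), w.re ∈ Set.Ioo 0 4 :=
      Complex.continuous_re.continuousAt.eventually (Ioo_mem_nhds (by simpa) (by simpa))
    exact h.filter_mono nhdsWithin_le_nhds
  have hsplit : ∃ᶠ w in 𝓝[≠] (c : ℂ),
      (w ∈ spectrum ℂ (freeHamiltonian + V) ∧ 0 < (1 : ℝ) * w.im) ∨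
      (w ∈ spectrum ℂ (freeHamiltonian + V) ∧ 0 < (-1 : ℝ) * w.im) := by
    refine (hfreq.and_eventually hnear).mono fun w hw => ?_
    obtain ⟨hw, hw0, hw4⟩ := hw
    rcases lt_trichotomy w.im 0 with h | h | h
    · exact Or.inr ⟨hw.1, by linarith⟩
    · have hreal : w = (w.re : ℂ) := Complex.ext rfl (by simpa using h)
      rw [hreal] at hw
      exact absurd hw (notMem_discreteSpectrum hcompact hw0 hw4)
    · exact Or.inl ⟨hw.1, by linarith⟩
  rcases frequently_or_distrib.mp hsplit with h | h
  · exact not_frequently_mem_spectrum_halfPlane hcompact hanalytic (Or.inl rfl)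
      hc0 hc4 h
  · exact not_frequently_mem_spectrum_halfPlane hcompact hanalytic (Or.inr rfl)
      hc0 hc4 h

end Perturbation

end

end ComplexScaling

theorem theorem2 (V : ComplexScaling.ellTwo →L[ℂ] ComplexScaling.ellTwo)
    (hcompact : IsCompactOperator V)
    (hanalytic : ComplexScaling.MemAnalyticClass ComplexScaling.conjugateOperator V) (z : ℂ)
    (hz : AccPt z
      (Filter.principal
        (ComplexScaling.discreteSpectrum (ComplexScaling.freeHamiltonian + V)))) :
    z = 0 ∨ z = 4 :=
  ComplexScaling.eq_zero_or_eq_four_of_frequently_mem_discreteSpectrum hcompact hanalytic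
    (accPt_iff_frequently_nhdsNE.mp hz)
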